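/- Let $A$ be an integer $n\times n$ matrix all of whose (complex) eigenvalues have modulus greater than $1$, let $D\subset\mathbb{Z}^n$ be finite and nonempty, and let $T=T(A,D)\subset\mathbb{R}^n$ be the self-affine set, i.e. the unique nonempty compact set with $A(T)=\bigcup_{d\in D}(T+d)$. Let $C\subset\mathbb{Z}^n$ be a finite set containing exactly one representative of every coset in $\mathbb{Z}^n/A(\mathbb{Z}^n)$, and let $K\subset\mathbb{Z}^n$ be any finite set with $C\cup D\subset K$. Let $\Gamma$ be the directed labeled graph with vertex set $\mathbb{Z}^n$ and an edge from $u$ to $v$ labeled $(x,y)\in K\times K$ whenever $u+x=y+Av$. Let $\mathcal{N}$ be its nucleus, the subgraph spanned by all directed cycles of $\Gamma$ and all vertices that can be reached from the cycles along directed paths. Let $\mathcal{N}_D$ be the graph obtained from $\mathcal{N}$ by keeping all vertices, removing every edge whose label is not in $C\times D$, and replacing every label $(a,b)$ by $a$. For a vertex $v$ of $\mathcal{N}_D$ let $F_v$ be the set of all left-infinite sequences $\ldots x_2x_1$, $x_i\in C$, which can be read along left-infinite paths in $\mathcal{N}_D$ that end in $v$. Let $\lambda$ be the Lebesgue measure on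 $\mathbb{R}^n$, and let $\mu$ be the uniform Bernoulli measure on the space $C^{-\omega}$ of left-infinite sequences over $C$, i.e. the product measure with $\mu(x)=1/|C|$ for $x\in C$. Then $\mathcal{N}_D$ has finitely many vertices, every set $F_v$ is closed in $C^{-\omega}$ (for the product topology of discrete sets), and for every $u\in\mathbb{Z}^n$ \[ \lambda(T\cap(T+u))=\sum_{\substack{v_1,v_2\in\mathcal{N}_D\\ u=v_2-v_1}}\mu(F_{v_1}\cap F_{v_2}). \] Moreover, let $\mathcal{N}_D\times\mathcal{N}_D$ be the labeled product, i.e. the graph whose vertices are the pairs of vertices of $\mathcal{N}_D$, with an edge $(u_1,u_2)\xrightarrow{x}(w_1,w_2)$ whenever $u_1\xrightarrow{x}w_1$ and $u_2\xrightarrow{x}w_2$ are edges of $\mathcal{N}_D$. Then for all vertices $v_1,v_2$ of $\mathcal{N}_D$ the set $F_{(v_1,v_2)}$ of left-infinite sequences read along left-infinite paths in $\mathcal{N}_D\times\mathcal{N}_D$ that end in $(v_1,v_2)$ is equal to $F_{v_1}\cap F_{v_2}$. -/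

import Mathlib

open MeasureTheory

/-- A directed graph with vertices in `V` whose edges carry labels in `X`;
`Edge u x v` says that there is an edge from `u` to `v` labeled by `x`. -/
structure LabeledGraph (V X : Type*) where
  verts : Set V
  Edge : V → X → V → Prop
  source_mem : ∀ {u x v}, Edge u x v → u ∈ verts
  target_mem : ∀ {u x v}, Edge u x v → v ∈ verts

namespace LabeledGraph

variable {V W X : Type*}

/-- There is an edge from `u` to `v`, with some label. -/
def Step (G : LabeledGraph V X) (u v : V) : Prop := ∃ x, G.Edge u x v

/-- `v` lies on a directed cycle: there is a closed directed path of positive length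
through `v`. -/
def OnCycle (G : LabeledGraph V X) (v : V) : Prop := Relation.TransGen G.Step v v

/-- The nucleus: the subgraph spanned by all cycles and by all vertices that can be
reached by directed paths from the cycles. -/
def nucleus (G : LabeledGraph V X) : LabeledGraph V X where
  verts := {v | v ∈ G.verts ∧ ∃ w, G.OnCycle w ∧ Relation.ReflTransGen G.Step w v}
  Edge u x v := G.Edge u x v ∧
    (∃ w, G.OnCycle w ∧ Relation.ReflTransGen G.Step w u) ∧
    (∃ w, G.OnCycle w ∧ Relation.ReflTransGen G.Step w v)
  source_mem h := ⟨G.source_mem h.1, h.2.1⟩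
  target_mem h := ⟨G.target_mem h.1, h.2.2⟩

/-- The set `F_v` of all left-infinite sequences `… x₂ x₁` which can be read along
left-infinite paths `… → p 2 → p 1 → p 0 = v` ending in `v`. A left-infinite sequence
`… x₂ x₁` is encoded as the function `ξ : ℕ → X` with `ξ k = x_{k+1}`. -/
def pathSet (G : LabeledGraph V X) (v : V) : Set (ℕ → X) :=
  {ξ | ∃ p : ℕ → V, p 0 = v ∧ ∀ k, G.Edge (p (k + 1)) (ξ k) (p k)}

/-- The labeled product of two graphs with labels in the same set. -/
def labeledProd (G : LabeledGraph V X) (H : LabeledGraph W X) : LabeledGraph (V × W) X where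
  verts := G.verts ×ˢ H.verts
  Edge u x v := G.Edge u.1 x v.1 ∧ H.Edge u.2 x v.2
  source_mem h := ⟨G.source_mem h.1, H.source_mem h.2⟩
  target_mem h := ⟨G.target_mem h.1, H.target_mem h.2⟩

end LabeledGraph

namespace SelfAffine

variable {n : ℕ}

/-- Every (complex) eigenvalue of `A` has modulus greater than `1`. -/
def IsExpanding (A : Matrix (Fin n) (Fin n) ℤ) : Prop :=
  ∀ z : ℂ, Module.End.HasEigenvalue (Matrix.toLin' (A.map (Int.cast : ℤ → ℂ))) z → 1 < ‖z‖

/-- The inclusion of `ℤⁿ` in `ℝⁿ`. -/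
def toReal (v : Fin n → ℤ) : Fin n → ℝ := fun i => (v i : ℝ)

/-- The translateBy `T + u`. -/
def translateBy (T : Set (Fin n → ℝ)) (u : Fin n → ℤ) : Set (Fin n → ℝ) :=
  (fun t => t + toReal u) '' T

/-- `T` is the self-affine set `T(A, D)`: the nonempty compact set with
`A(T) = ⋃_{d ∈ D} (T + d)`. -/
structure IsSelfAffineSet (A : Matrix (Fin n) (Fin n) ℤ) (D : Finset (Fin n → ℤ))
    (T : Set (Fin n → ℝ)) : Prop where
  nonempty : T.Nonempty
  isCompact : IsCompact T
  image_eq : (fun t => (A.map (Int.cast : ℤ → ℝ)).mulVec t) '' T = ⋃ d ∈ D, translateBy T d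

/-- `C` contains exactly one representative of every coset in `ℤⁿ / A(ℤⁿ)`. -/
def IsCosetTransversal (A : Matrix (Fin n) (Fin n) ℤ) (C : Finset (Fin n → ℤ)) : Prop :=
  ∀ v : Fin n → ℤ, ∃! c, c ∈ C ∧ ∃ w : Fin n → ℤ, v = c + A.mulVec w

theorem IsCosetTransversal.nonempty {A : Matrix (Fin n) (Fin n) ℤ} {C : Finset (Fin n → ℤ)}
    (hC : IsCosetTransversal A C) : C.Nonempty :=
  let ⟨c, hc, _⟩ := hC 0
  ⟨c, hc.1⟩

/-- The graph `Γ(A, K)` with vertex set `ℤⁿ` and an edge from `u` to `v` labeled by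
`(x, y) ∈ K × K` whenever `u + x = y + A v`. -/
def automaton (A : Matrix (Fin n) (Fin n) ℤ) (K : Finset (Fin n → ℤ)) :
    LabeledGraph (Fin n → ℤ) (K × K) where
  verts := Set.univ
  Edge u l v := u + (l.1 : Fin n → ℤ) = (l.2 : Fin n → ℤ) + A.mulVec v
  source_mem _ := Set.mem_univ _
  target_mem _ := Set.mem_univ _

/-- The graph `𝒩_D`: in the nucleus of `Γ(A, K)`, remove every edge whose label is not in
`C × D`, and replace every label `(a, b)` by `a`. -/
def digitGraph (A : Matrix (Fin n) (Fin n) ℤ) (K C D : Finset (Fin n → ℤ)) :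
    LabeledGraph (Fin n → ℤ) C where
  verts := (automaton A K).nucleus.verts
  Edge u a v := ∃ l : K × K, (l.1 : Fin n → ℤ) = a ∧ (l.2 : Fin n → ℤ) ∈ D ∧
    (automaton A K).nucleus.Edge u l v
  source_mem := fun ⟨_, _, _, h⟩ => LabeledGraph.source_mem _ h
  target_mem := fun ⟨_, _, _, h⟩ => LabeledGraph.target_mem _ h

/-- The uniform Bernoulli measure on the space of sequences in `C`: the product of the
measures giving mass `1 / |C|` to every element of `C`. -/
noncomputable def bernoulliMeasure (C : Finset (Fin n → ℤ)) (hC : C.Nonempty) : Measure (ℕ → C) :=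
  haveI : Nonempty C := hC.to_subtype
  Measure.infinitePi fun _ : ℕ => (PMF.uniformOfFintype C).toMeasure

end SelfAffine

/-! Let `B` be the inverse of `A`. Since `A` is expanding, `∑ ‖B ^ k‖` converges, and every sequence
`ξ` over `C` has a point `expansion B ξ = ∑ B ^ (k + 1) ξ_k`. An edge `u + x = y + A v` says `v = B
(u + x - y)`, so a path reading `ξ` converts `C`-digits into `D`-digits up to an integer carry.
Hence `F_v` is exactly the set of `ξ` with `expansion B ξ - v ∈ T` (`mem_pathSet_digitGraph_iff`):
carries in the nucleus are bounded, and conversely a path with bounded carries repeats vertices and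
so lies in the nucleus. Closedness follows by continuity.

Consequently `F_w ∩ F_(w+u)` is the event `expansion B ξ - w ∈ T ∩ (T + u)`, and the sum over `w` is
the mass of `T ∩ (T + u)` under `latticeSum`. This measure is Lebesgue measure
(`latticeSum_eq_volume`): it is invariant under `ℤⁿ`, self-similarity extends this to all `B ^ k
ℤⁿ`, whose union is dense, and uniqueness of Haar measure leaves a constant, fixed by the unit cube.
-/

namespace SelfAffine

open Filter Topology
open scoped ENNReal NNReal

/-! ### Summability of the powers of the inverse matrix -/

section Expanding

attribute [local instance] Matrix.linftyOpNormedRing Matrix.linftyOpNormedAlgebra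

/-- Gelfand's formula: for `r` strictly between the spectral radius and `1`, eventually `‖a ^ k‖ ≤ r
^ k`. -/
theorem summable_norm_pow_of_spectralRadius_lt_one {R : Type*} [NormedRing R] [NormedAlgebra ℂ R]
    [CompleteSpace R] {a : R} (ha : spectralRadius ℂ a < 1) : Summable fun k : ℕ => ‖a ^ k‖ := by
  obtain ⟨r, hr, hr1⟩ := ENNReal.lt_iff_exists_nnreal_btwn.1 ha
  have hr1' : (r : ℝ) < 1 := by exact_mod_cast hr1
  refine Summable.of_norm_bounded_eventually_nat
    (summable_geometric_of_lt_one r.coe_nonneg hr1') ?_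
  filter_upwards [(spectrum.pow_nnnorm_pow_one_div_tendsto_nhds_spectralRadius a).eventually_lt_const
    hr, eventually_gt_atTop 0] with k hk hk0
  have hk0' : (0 : ℝ) < k := by exact_mod_cast hk0
  have h := ENNReal.rpow_le_rpow hk.le hk0'.le
  rw [← ENNReal.rpow_mul, one_div, inv_mul_cancel₀ hk0'.ne', ENNReal.rpow_one,
    ENNReal.rpow_natCast] at h
  rw [norm_norm]
  exact_mod_cast h

theorem summable_norm_inv_pow {n : ℕ} {M : Matrix (Fin n) (Fin n) ℂ}
    (hM : ∀ z, Module.End.HasEigenvalue (Matrix.toLin' M) z → 1 < ‖z‖) :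
    IsUnit M ∧ Summable fun k : ℕ => ‖M⁻¹ ^ k‖ := by
  have hs : ∀ z ∈ spectrum ℂ M, 1 < ‖z‖ := fun z hz => hM z <| by
    rwa [Module.End.hasEigenvalue_iff_mem_spectrum, Matrix.spectrum_toLin']
  have hu : IsUnit M := by
    by_contra h
    have := hs 0 (spectrum.zero_mem_iff ℂ |>.2 h)
    norm_num at this
  refine ⟨hu, summable_norm_pow_of_spectralRadius_lt_one ?_⟩
  -- The spectrum is empty when `n = 0`.
  rcases (spectrum ℂ M⁻¹).eq_empty_or_nonempty with he | hne
  · simp [spectralRadius, he]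
  · refine mod_cast spectrum.spectralRadius_lt_of_forall_lt_of_nonempty hne (r := 1) fun z hz => ?_
    obtain ⟨U, rfl⟩ := hu
    rw [← Matrix.coe_units_inv, ← spectrum.map_inv, Set.mem_inv] at hz
    have h1 := hs _ hz
    rw [norm_inv] at h1
    have h0 : 0 < ‖z‖ := by
      by_contra h
      have : ‖z‖ = 0 := le_antisymm (not_lt.1 h) (norm_nonneg _)
      norm_num [this] at h1
    exact (one_lt_inv₀ h0).1 h1

/-- An expanding integer matrix is invertible over the reals, and the norms of the powers of its
inverse are summable. -/
theorem IsExpanding.exists_inverse {n : ℕ} {A : Matrix (Fin n) (Fin n) ℤ} (hA : IsExpanding A) :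
    ∃ B : (Fin n → ℝ) →L[ℝ] (Fin n → ℝ),
      (∀ x, B ((A.map (Int.cast : ℤ → ℝ)).mulVec x) = x) ∧
      (∀ x, (A.map (Int.cast : ℤ → ℝ)).mulVec (B x) = x) ∧ Summable fun k : ℕ => ‖B ^ k‖ := by
  obtain ⟨hu, hsum⟩ := summable_norm_inv_pow hA
  set Ar : Matrix (Fin n) (Fin n) ℝ := A.map Int.cast with hAr
  have hdet : Ar.det ≠ 0 := by
    rw [Matrix.isUnit_iff_isUnit_det, isUnit_iff_ne_zero] at hu
    have h1 : (A.map (Int.cast : ℤ → ℂ)).det = (A.det : ℂ) := (Int.castRingHom ℂ).map_det A |>.symm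
    have h2 : Ar.det = (A.det : ℝ) := (Int.castRingHom ℝ).map_det A |>.symm
    rw [h1] at hu
    rw [h2]
    exact_mod_cast hu
  have hud : IsUnit Ar.det := isUnit_iff_ne_zero.2 hdet
  have hmap : (Ar⁻¹).map ((↑) : ℝ → ℂ) = (A.map (Int.cast : ℤ → ℂ))⁻¹ := by
    symm
    apply Matrix.inv_eq_left_inv
    have : A.map (Int.cast : ℤ → ℂ) = Ar.map ((↑) : ℝ → ℂ) := by
      ext i j; simp [hAr]
    rw [this]
    have h := congrArg Complex.ofRealHom.mapMatrix (Matrix.nonsing_inv_mul Ar hud)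
    rw [map_mul, map_one] at h
    exact h
  -- The operator norm for the sup norm depends only on the absolute values of the entries, so
  -- complexification preserves it.
  have hpow : ∀ k : ℕ, ‖Ar⁻¹ ^ k‖ = ‖(A.map (Int.cast : ℤ → ℂ))⁻¹ ^ k‖ := by
    intro k
    rw [← hmap]
    have h : ((Ar⁻¹).map ((↑) : ℝ → ℂ)) ^ k = (Ar⁻¹ ^ k).map ((↑) : ℝ → ℂ) :=
      (map_pow Complex.ofRealHom.mapMatrix Ar⁻¹ k).symm
    rw [h]
    simp only [Matrix.linfty_opNorm_def, Matrix.map_apply]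
    simp
  set B : (Fin n → ℝ) →L[ℝ] (Fin n → ℝ) := LinearMap.toContinuousLinearMap (Matrix.toLin' Ar⁻¹)
    with hB
  have hBk : ∀ (k : ℕ) x, (B ^ k) x = (Ar⁻¹ ^ k).mulVec x := by
    intro k
    induction k with
    | zero => simp
    | succ k ih =>
      intro x
      rw [pow_succ, pow_succ, ← Matrix.mulVec_mulVec, mul_apply_eq_comp, ih]
      simp [hB]
  refine ⟨B, fun x => ?_, fun x => ?_, ?_⟩
  · simp [hB, Matrix.nonsing_inv_mul Ar hud]
  · simp [hB, Matrix.mul_nonsing_inv Ar hud]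
  · refine Summable.of_nonneg_of_le (fun _ => norm_nonneg _) (fun k => ?_) hsum
    rw [← hpow]
    refine ContinuousLinearMap.opNorm_le_bound _ (norm_nonneg _) fun x => ?_
    rw [hBk]
    exact Matrix.linfty_opNorm_mulVec _ _

end Expanding

/-! ### Series with bounded digits -/

section DigitSeries

variable {E : Type*} [NormedAddCommGroup E] [NormedSpace ℝ E] {B : E →L[ℝ] E}

theorem norm_pow_apply_le {M : ℝ} {x : E} (hx : ‖x‖ ≤ M) (k : ℕ) :
    ‖(B ^ k) x‖ ≤ ‖B ^ k‖ * M :=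
  ((B ^ k).le_opNorm x).trans (by gcongr)

theorem tendsto_pow_apply_of_bounded (hB : Summable fun k : ℕ => ‖B ^ k‖) {x : ℕ → E} {M : ℝ}
    (hx : ∀ k, ‖x k‖ ≤ M) : Tendsto (fun k => (B ^ k) (x k)) atTop (𝓝 0) :=
  squeeze_zero_norm (fun k => norm_pow_apply_le (hx k) k)
    (by simpa using hB.tendsto_atTop_zero.mul_const M)

/-- The sum of the series `B a₀ + B² a₁ + B³ a₂ + ⋯`. -/
noncomputable def digitSum (B : E →L[ℝ] E) (a : ℕ → E) : E := ∑' k, (B ^ (k + 1)) (a k)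

theorem summable_norm_pow_succ (hB : Summable fun k : ℕ => ‖B ^ k‖) (M : ℝ) :
    Summable fun k : ℕ => ‖B ^ (k + 1)‖ * M :=
  ((summable_nat_add_iff 1).2 hB).mul_right M

theorem norm_digitSum_le (hB : Summable fun k : ℕ => ‖B ^ k‖) {a : ℕ → E} {M : ℝ}
    (ha : ∀ k, ‖a k‖ ≤ M) : ‖digitSum B a‖ ≤ ∑' k : ℕ, ‖B ^ (k + 1)‖ * M :=
  tsum_of_norm_bounded (summable_norm_pow_succ hB M).hasSum fun k => norm_pow_apply_le (ha k) _

theorem digitSum_eq [CompleteSpace E] (hB : Summable fun k : ℕ => ‖B ^ k‖) {a : ℕ → E} {M : ℝ}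
    (ha : ∀ k, ‖a k‖ ≤ M) : digitSum B a = B (a 0 + digitSum B fun k => a (k + 1)) := by
  have h : ∀ b : ℕ → E, (∀ k, ‖b k‖ ≤ M) → Summable fun k => (B ^ (k + 1)) (b k) := fun b hb =>
    Summable.of_norm_bounded (summable_norm_pow_succ hB M) fun k => norm_pow_apply_le (hb k) _
  rw [digitSum, (h a ha).tsum_eq_zero_add, map_add, digitSum,
    B.map_tsum (h _ fun k => ha (k + 1))]
  rw [zero_add, pow_one]
  congr 1
  refine tsum_congr fun k => ?_
  rw [pow_succ' B (k + 1)]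
  rfl

theorem continuous_digitSum [CompleteSpace E] {X : Type*} [TopologicalSpace X]
    (hB : Summable fun k : ℕ => ‖B ^ k‖) {a : X → ℕ → E} {M : ℝ} (ha : ∀ x k, ‖a x k‖ ≤ M)
    (hc : ∀ k, Continuous fun x => a x k) : Continuous fun x => digitSum B (a x) :=
  continuous_tsum (fun k => (B ^ (k + 1)).continuous.comp (hc k)) (summable_norm_pow_succ hB M)
    fun k x => norm_pow_apply_le (ha x k) _

end DigitSeries

end SelfAffine

/-! ### Paths in labeled graphs -/

namespace LabeledGraph

variable {V W X : Type*}

/-- A left-infinite path that visits only finitely many vertices stays in the nucleus. -/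
theorem mem_nucleus_of_finite_range {G : LabeledGraph V X} {p : ℕ → V} (hp : (Set.range p).Finite)
    (hs : ∀ k, G.Step (p (k + 1)) (p k)) (k : ℕ) :
    ∃ w, G.OnCycle w ∧ Relation.ReflTransGen G.Step w (p k) := by
  have hchain : ∀ i d, Relation.ReflTransGen G.Step (p (i + d)) (p i) := by
    intro i d
    induction d with
    | zero => exact .refl
    | succ d ih => exact .head (hs (i + d)) ih
  have hmaps : Set.MapsTo (fun j => p (k + j)) Set.univ (Set.range p) := fun j _ => ⟨_, rfl⟩
  -- Pigeonhole gives a repeated vertex. Indices decrease along the path, so the segment from the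
  -- larger index to the smaller one is the cycle.
  obtain ⟨i, -, j, -, hij, he⟩ := Set.infinite_univ.exists_lt_map_eq_of_mapsTo hmaps hp
  refine ⟨p (k + i), ?_, hchain k i⟩
  obtain ⟨d, rfl⟩ := Nat.exists_eq_add_of_lt hij
  have h : Relation.TransGen G.Step (p (k + (i + d + 1))) (p (k + i)) := by
    have h1 := hchain (k + i) d
    rw [show k + (i + d + 1) = k + i + d + 1 by ring]
    exact Relation.TransGen.head' (hs _) h1
  rwa [← show p (k + i) = p (k + (i + d + 1)) from he] at h

theorem pathSet_labeledProd (G : LabeledGraph V X) (H : LabeledGraph W X) (v : V) (w : W) :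
    (G.labeledProd H).pathSet (v, w) = G.pathSet v ∩ H.pathSet w := by
  ext ξ
  constructor
  · rintro ⟨p, h0, hp⟩
    exact ⟨⟨fun k => (p k).1, by simp [h0], fun k => (hp k).1⟩,
      ⟨fun k => (p k).2, by simp [h0], fun k => (hp k).2⟩⟩
  · rintro ⟨⟨p, h0, hp⟩, ⟨q, h0', hq⟩⟩
    exact ⟨fun k => (p k, q k), by simp [h0, h0'], fun k => ⟨hp k, hq k⟩⟩

end LabeledGraph

namespace SelfAffine

open Filter Topology

/-! ### Boundedness of the nucleus and description of the path sets -/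

section LongPaths

variable {E : Type*} [NormedAddCommGroup E] [NormedSpace ℝ E] {B : E →L[ℝ] E}

/-- `v` is obtained from `w` by `L` steps of the form `x ↦ B (x + a)` with `‖a‖ ≤ M`. -/
def ContractsTo (B : E →L[ℝ] E) (M : ℝ) (L : ℕ) (w v : E) : Prop :=
  ∃ a : ℕ → E, (∀ k, ‖a k‖ ≤ M) ∧ v = (B ^ L) w + ∑ j ∈ Finset.range L, (B ^ (j + 1)) (a j)

theorem ContractsTo.step {M : ℝ} {L : ℕ} {w v : E} (h : ContractsTo B M L w v) {b : E}
    (hb : ‖b‖ ≤ M) : ContractsTo B M (L + 1) w (B (v + b)) := by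
  obtain ⟨a, ha, rfl⟩ := h
  refine ⟨fun k => Nat.casesOn k b a, fun k => ?_, ?_⟩
  · cases k with
    | zero => exact hb
    | succ k => exact ha k
  · rw [Finset.sum_range_succ', map_add, map_add, map_sum, add_assoc, pow_succ' B L, zero_add,
      pow_one]
    congr 2
    refine Finset.sum_congr rfl fun k _ => ?_
    rw [pow_succ' B (k + 1)]
    rfl

/-- As the number of steps grows, the contribution of `w` dies out and only the digit series
remains, so the bound does not depend on `w`. -/
theorem norm_le_of_contractsTo (hB : Summable fun k : ℕ => ‖B ^ k‖) {M : ℝ} {w v : E} (hM : 0 ≤ M)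
    (h : ∀ m, ∃ L ≥ m, ContractsTo B M L w v) : ‖v‖ ≤ ∑' k : ℕ, ‖B ^ (k + 1)‖ * M := by
  choose L hL hc using h
  have hLt : Tendsto L atTop atTop := tendsto_atTop_mono hL tendsto_id
  have h0 : Tendsto (fun m => ‖B ^ L m‖ * ‖w‖ + ∑' k : ℕ, ‖B ^ (k + 1)‖ * M) atTop
      (𝓝 (0 * ‖w‖ + ∑' k : ℕ, ‖B ^ (k + 1)‖ * M)) :=
    ((hB.tendsto_atTop_zero.comp hLt).mul_const _).add_const _
  rw [zero_mul, zero_add] at h0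
  refine ge_of_tendsto' h0 fun m => ?_
  obtain ⟨a, ha, hv⟩ := hc m
  rw [hv]
  refine (norm_add_le _ _).trans (add_le_add ((B ^ L m).le_opNorm w) ?_)
  refine (norm_sum_le_of_le _ fun j _ => norm_pow_apply_le (ha j) (j + 1)).trans ?_
  exact (summable_norm_pow_succ hB M).sum_le_tsum _ fun _ _ => by positivity

end LongPaths

variable {n : ℕ} {A : Matrix (Fin n) (Fin n) ℤ} {B : (Fin n → ℝ) →L[ℝ] (Fin n → ℝ)}

theorem toReal_add (u v : Fin n → ℤ) : toReal (u + v) = toReal u + toReal v := by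
  ext; simp [toReal]

theorem toReal_sub (u v : Fin n → ℤ) : toReal (u - v) = toReal u - toReal v := by
  ext; simp [toReal]

theorem toReal_injective : Function.Injective (toReal : (Fin n → ℤ) → (Fin n → ℝ)) :=
  fun u v h => funext fun i => by simpa [toReal] using congrFun h i

theorem norm_toReal (v : Fin n → ℤ) : ‖toReal v‖ = ‖v‖ := by
  simp only [Pi.norm_def, toReal]
  congr 2

theorem toReal_mulVec (A : Matrix (Fin n) (Fin n) ℤ) (v : Fin n → ℤ) :
    toReal (A.mulVec v) = (A.map (Int.cast : ℤ → ℝ)).mulVec (toReal v) := by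
  ext i
  simp [toReal, Matrix.mulVec, dotProduct]

theorem finite_setOf_norm_toReal_le (n : ℕ) (R : ℝ) : {v : Fin n → ℤ | ‖toReal v‖ ≤ R}.Finite := by
  have : {v : Fin n → ℤ | ‖toReal v‖ ≤ R} = Metric.closedBall 0 R := by
    ext v
    simp [norm_toReal]
  rw [this]
  exact (isCompact_closedBall (0 : Fin n → ℤ) R).finite_of_discrete

theorem exists_norm_toReal_le (K : Finset (Fin n → ℤ)) : ∃ M : ℝ, 0 ≤ M ∧ ∀ x ∈ K, ‖toReal x‖ ≤ M :=
  ⟨∑ x ∈ K, ‖toReal x‖, Finset.sum_nonneg fun _ _ => norm_nonneg _, fun _ hx =>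
    Finset.single_le_sum (f := fun x => ‖toReal x‖) (fun _ _ => norm_nonneg _) hx⟩

theorem toReal_eq_of_edge (hBA : ∀ x, B ((A.map (Int.cast : ℤ → ℝ)).mulVec x) = x)
    {u x y v : Fin n → ℤ} (h : u + x = y + A.mulVec v) :
    toReal v = B (toReal u + (toReal x - toReal y)) := by
  have h' := congrArg toReal h
  rw [toReal_add, toReal_add, toReal_mulVec] at h'
  rw [← hBA (toReal v), ← add_sub_assoc, h', add_sub_cancel_left]

/-- The nucleus of the automaton of an expanding matrix is bounded. -/
theorem exists_norm_le_of_mem_nucleus (hB : Summable fun k : ℕ => ‖B ^ k‖)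
    (hBA : ∀ x, B ((A.map (Int.cast : ℤ → ℝ)).mulVec x) = x) (K : Finset (Fin n → ℤ)) :
    ∃ R : ℝ, ∀ v ∈ (automaton A K).nucleus.verts, ‖toReal v‖ ≤ R := by
  obtain ⟨M, hM0, hM⟩ := exists_norm_toReal_le K
  refine ⟨∑' k : ℕ, ‖B ^ (k + 1)‖ * (M + M), ?_⟩
  rintro v ⟨-, w, hw, hwv⟩
  have hstep : ∀ {L : ℕ} {u v : Fin n → ℤ}, ContractsTo B (M + M) L (toReal w) (toReal u) →
      (automaton A K).Step u v → ContractsTo B (M + M) (L + 1) (toReal w) (toReal v) := by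
    rintro L u v h ⟨⟨x, y⟩, he⟩
    rw [toReal_eq_of_edge hBA he]
    exact h.step ((norm_sub_le _ _).trans (add_le_add (hM _ x.2) (hM _ y.2)))
  -- Each further turn around the cycle adds at least one step, which gives arbitrarily long paths
  -- from `w` to itself.
  have hcycle : ∀ m, ∃ L ≥ m, ContractsTo B (M + M) L (toReal w) (toReal w) := by
    intro m
    induction m with
    | zero => exact ⟨0, le_rfl, fun _ => 0, fun _ => by simpa using add_nonneg hM0 hM0, by simp⟩
    | succ m ih =>
      obtain ⟨L, hL, hc⟩ := ih
      have : ∀ v, Relation.TransGen (automaton A K).Step w v →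
          ∃ L ≥ m + 1, ContractsTo B (M + M) L (toReal w) (toReal v) := by
        intro v hv
        induction hv with
        | single h => exact ⟨L + 1, by omega, hstep hc h⟩
        | tail _ h ih =>
          obtain ⟨L', hL', hc'⟩ := ih
          exact ⟨L' + 1, by omega, hstep hc' h⟩
      exact this w hw
  refine norm_le_of_contractsTo hB (w := toReal w) (add_nonneg hM0 hM0) fun m => ?_
  induction hwv with
  | refl => exact hcycle m
  | tail _ h ih =>
    obtain ⟨L, hL, hc⟩ := ih
    exact ⟨L + 1, by omega, hstep hc h⟩

theorem finite_digitGraph_verts (hA : IsExpanding A) (K C D : Finset (Fin n → ℤ)) :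
    (digitGraph A K C D).verts.Finite := by
  obtain ⟨B, hBA, -, hB⟩ := hA.exists_inverse
  obtain ⟨R, hR⟩ := exists_norm_le_of_mem_nucleus hB hBA K
  exact (finite_setOf_norm_toReal_le n R).subset hR

theorem mem_translateBy {T : Set (Fin n → ℝ)} {u : Fin n → ℤ} {x : Fin n → ℝ} :
    x ∈ translateBy T u ↔ x - toReal u ∈ T := by
  constructor
  · rintro ⟨t, ht, rfl⟩
    simpa using ht
  · intro h
    exact ⟨_, h, by simp⟩

/-- A bounded orbit of the inverse branches `t ↦ B (t + d)` lies in the self-affine set. -/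
theorem IsSelfAffineSet.mem_of_bounded_orbit {D : Finset (Fin n → ℤ)} {T : Set (Fin n → ℝ)}
    (hT : IsSelfAffineSet A D T) (hB : Summable fun k : ℕ => ‖B ^ k‖)
    (hBA : ∀ x, B ((A.map (Int.cast : ℤ → ℝ)).mulVec x) = x)
    {t : ℕ → Fin n → ℝ} {R : ℝ} (ht : ∀ k, ‖t k‖ ≤ R)
    (hd : ∀ k, ∃ d ∈ D, t k = B (t (k + 1) + toReal d)) : t 0 ∈ T := by
  obtain ⟨s, hs⟩ := hT.nonempty
  have hTB : ∀ x ∈ T, ∀ d ∈ D, B (x + toReal d) ∈ T := by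
    intro x hx d hd
    have : x + toReal d ∈ ⋃ d ∈ D, translateBy T d := Set.mem_biUnion hd ⟨x, hx, rfl⟩
    rw [← hT.image_eq] at this
    obtain ⟨y, hy, hxy⟩ := this
    rw [← hxy, hBA]
    exact hy
  -- The point `x` arises by applying to `s` the same `m` inverse branches that lead from `t (k +
  -- m)` to `t k`.
  have key : ∀ m k, ∃ x ∈ T, t k - x = (B ^ m) (t (k + m) - s) := by
    intro m
    induction m with
    | zero => exact fun k => ⟨s, hs, by simp⟩
    | succ m ih =>
      intro k
      obtain ⟨x, hx, he⟩ := ih (k + 1)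
      obtain ⟨d, hdD, hdk⟩ := hd k
      refine ⟨_, hTB x hx d hdD, ?_⟩
      rw [hdk, ← map_sub, add_sub_add_right_eq_sub, he, pow_succ' B m, add_assoc, add_comm 1 m]
      rfl
  choose x hxT hx using fun m => key m 0
  have hlim : Tendsto (fun m => t 0 - x m) atTop (𝓝 0) := by
    simp_rw [hx]
    exact tendsto_pow_apply_of_bounded hB (M := R + ‖s‖) fun m =>
      (norm_sub_le _ _).trans (add_le_add_left (ht _) _)
  have hlim' : Tendsto x atTop (𝓝 (t 0)) := by
    simpa using (tendsto_const_nhds (x := t 0)).sub hlim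
  exact hT.isCompact.isClosed.mem_of_tendsto hlim' (Eventually.of_forall hxT)

/-- The point `∑ B^(k+1) ξ_k` with integer digits `ξ`. -/
noncomputable def expansion (B : (Fin n → ℝ) →L[ℝ] (Fin n → ℝ)) {C : Finset (Fin n → ℤ)}
    (ξ : ℕ → C) : Fin n → ℝ :=
  digitSum B fun k => toReal (ξ k : Fin n → ℤ)

section Expansion

variable {C : Finset (Fin n → ℤ)}

theorem expansion_eq (hB : Summable fun k : ℕ => ‖B ^ k‖) (ξ : ℕ → C) :
    expansion B ξ = B (toReal (ξ 0 : Fin n → ℤ) + expansion B fun k => ξ (k + 1)) := by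
  obtain ⟨M, -, hM⟩ := exists_norm_toReal_le C
  exact digitSum_eq hB fun k => hM _ (ξ k).2

theorem exists_norm_expansion_le (hB : Summable fun k : ℕ => ‖B ^ k‖) (C : Finset (Fin n → ℤ)) :
    ∃ R : ℝ, ∀ ξ : ℕ → C, ‖expansion B ξ‖ ≤ R := by
  obtain ⟨M, -, hM⟩ := exists_norm_toReal_le C
  exact ⟨_, fun ξ => norm_digitSum_le hB fun k => hM _ (ξ k).2⟩

theorem continuous_expansion (hB : Summable fun k : ℕ => ‖B ^ k‖) :
    Continuous (expansion B : (ℕ → C) → Fin n → ℝ) := by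
  obtain ⟨M, -, hM⟩ := exists_norm_toReal_le C
  refine continuous_digitSum hB (fun ξ k => hM _ (ξ k).2) fun k => ?_
  exact (continuous_of_discreteTopology (f := fun c : C => toReal (c : Fin n → ℤ))).comp
    (continuous_apply k)

/-- The set of sequences read along paths ending in `v` consists of the sequences whose expansion
lies in `T + v`. -/
theorem mem_pathSet_digitGraph_iff {D K : Finset (Fin n → ℤ)} {T : Set (Fin n → ℝ)}
    (hT : IsSelfAffineSet A D T) (hDK : D ⊆ K) (hCK : C ⊆ K)
    (hB : Summable fun k : ℕ => ‖B ^ k‖)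
    (hBA : ∀ x, B ((A.map (Int.cast : ℤ → ℝ)).mulVec x) = x)
    (hAB : ∀ x, (A.map (Int.cast : ℤ → ℝ)).mulVec (B x) = x) (v : Fin n → ℤ) (ξ : ℕ → C) :
    ξ ∈ (digitGraph A K C D).pathSet v ↔ expansion B ξ - toReal v ∈ T := by
  obtain ⟨R, hR⟩ := exists_norm_expansion_le hB C
  set τ : ℕ → Fin n → ℝ := fun k => expansion B fun j => ξ (j + k) with hτ
  have hτs : ∀ k, τ k = B (toReal (ξ k : Fin n → ℤ) + τ (k + 1)) := by
    intro k
    simp only [hτ]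
    rw [expansion_eq hB]
    simp only [zero_add, add_assoc, add_comm 1 k]
  constructor
  · rintro ⟨p, rfl, hp⟩
    obtain ⟨R', hR'⟩ := exists_norm_le_of_mem_nucleus hB hBA K
    have hpn : ∀ k, ‖toReal (p k)‖ ≤ R' := fun k => hR' _ ((digitGraph A K C D).target_mem (hp k))
    -- The differences of tail expansions and carries form an orbit whose digits are the second
    -- labels `y` of the edges.
    refine hT.mem_of_bounded_orbit (t := fun k => τ k - toReal (p k)) (R := R + R') hB hBA
      (fun k => (norm_sub_le _ _).trans (add_le_add (hR _) (hpn k))) fun k => ?_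
    obtain ⟨⟨x, y⟩, hx, hy, he, -⟩ := hp k
    refine ⟨y, hy, ?_⟩
    simp only at hx
    rw [hτs k, toReal_eq_of_edge hBA he, ← map_sub, hx]
    congr 1
    abel
  · intro hv
    have hTA : ∀ t : T, ∃ (d : D) (t' : T), (A.map (Int.cast : ℤ → ℝ)).mulVec t =
        t' + toReal (d : Fin n → ℤ) := by
      rintro ⟨t, ht⟩
      have : (A.map (Int.cast : ℤ → ℝ)).mulVec t ∈ ⋃ d ∈ D, translateBy T d := by
        rw [← hT.image_eq]
        exact ⟨t, ht, rfl⟩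
      simp only [Set.mem_iUnion] at this
      obtain ⟨d, hd, t', ht', he⟩ := this
      exact ⟨⟨d, hd⟩, ⟨t', ht'⟩, he.symm⟩
    choose δ next hnext using hTA
    let t : ℕ → T := fun k => Nat.rec ⟨_, hv⟩ (fun _ s => next s) k
    -- Each carry is forced by the edge equation once the `D`-digits of `t 0` are chosen. It equals
    -- `τ k - t k`, a difference of bounded quantities.
    let p : ℕ → Fin n → ℤ := fun k =>
      Nat.rec v (fun k q => δ (t k) + A.mulVec q - ξ k) k
    have hps : ∀ k, p (k + 1) = δ (t k) + A.mulVec (p k) - ξ k := fun k => rfl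
    have hts : ∀ k, t (k + 1) = next (t k) := fun k => rfl
    have hpt : ∀ k, toReal (p k) = τ k - (t k).1 := by
      intro k
      induction k with
      | zero => simp [p, t, hτ]
      | succ k ih =>
        have h1 := hnext (t k)
        have h2 : (A.map (Int.cast : ℤ → ℝ)).mulVec (τ k) =
            toReal (ξ k : Fin n → ℤ) + τ (k + 1) := by rw [hτs k, hAB]
        rw [hps, toReal_sub, toReal_add, toReal_mulVec, ih, Matrix.mulVec_sub, h1, h2, hts]
        abel
    obtain ⟨R', hR'⟩ := hT.isCompact.isBounded.exists_norm_le
    have hfin : (Set.range p).Finite := by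
      refine (finite_setOf_norm_toReal_le n (R + R')).subset ?_
      rintro _ ⟨k, rfl⟩
      simp only [Set.mem_ofPred_eq, hpt]
      exact (norm_sub_le _ _).trans (add_le_add (hR _) (hR' _ (t k).2))
    have hedge : ∀ k, (automaton A K).Edge (p (k + 1))
        (⟨ξ k, hCK (ξ k).2⟩, ⟨δ (t k), hDK (δ (t k)).2⟩) (p k) := by
      intro k
      simp [automaton, hps]
    have hnuc := LabeledGraph.mem_nucleus_of_finite_range hfin fun k => ⟨_, hedge k⟩
    exact ⟨p, rfl, fun k => ⟨_, rfl, (δ (t k)).2, hedge k, hnuc (k + 1), hnuc k⟩⟩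

end Expansion

end SelfAffine

/-! ### Invariant measures and the Bernoulli measure -/

namespace SelfAffine

open Filter Topology
open scoped ENNReal

section Invariance

variable {E : Type*} [NormedAddCommGroup E] [ProperSpace E] [MeasurableSpace E] [BorelSpace E]

/-- A locally finite measure invariant under a dense set of translations is invariant under all
translations. -/
theorem isAddLeftInvariant_of_dense {N : Measure E} [IsFiniteMeasureOnCompacts N] {s : Set E}
    (hs : Dense s) (h : ∀ t ∈ s, N.map (t + ·) = N) : N.IsAddLeftInvariant := by
  refine ⟨fun t => ?_⟩
  have : (N.map (t + ·)).Regular := Measure.Regular.map (Homeomorph.addLeft t)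
  refine Measure.ext_of_integral_eq_on_compactlySupported fun f => ?_
  have hmap : ∀ t : E, ∫ x, f x ∂N.map (t + ·) = ∫ x, f (t + x) ∂N := fun t =>
    (Homeomorph.addLeft t).measurableEmbedding.integral_map _
  have hcont : Continuous fun t : E => ∫ x, f (t + x) ∂N := by
    -- The cited continuity concerns `-x + t`; reflecting `f` here, and `t` in the next step, turns
    -- it into `t + x`.
    have := continuous_integral_apply_neg_add (μ := N) (g := fun x => f (-x))
      (f.continuous.comp continuous_neg) (f.hasCompactSupport.comp_homeomorph (Homeomorph.neg E))
    have h2 := this.comp continuous_neg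
    refine h2.congr fun t => ?_
    simp [add_comm]
  have heq := Continuous.ext_on hs hcont (continuous_const (y := ∫ x, f x ∂N)) fun t ht => by
    rw [← hmap, h t ht]
  rw [hmap]
  exact congrFun heq t

end Invariance

variable {n : ℕ} {A : Matrix (Fin n) (Fin n) ℤ} {B : (Fin n → ℝ) →L[ℝ] (Fin n → ℝ)}
  {C : Finset (Fin n → ℤ)}

/-- Prepend a letter to a sequence. -/
def consSeq {X : Type*} (c : X) (ξ : ℕ → X) : ℕ → X
  | 0 => c
  | k + 1 => ξ k

theorem measurable_consSeq {X : Type*} [MeasurableSpace X] (c : X) :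
    Measurable (consSeq c : (ℕ → X) → ℕ → X) :=
  measurable_pi_iff.2 fun k => match k with
    | 0 => measurable_const
    | k + 1 => measurable_pi_apply k

instance isProbabilityMeasure_bernoulliMeasure (hC : C.Nonempty) :
    IsProbabilityMeasure (bernoulliMeasure C hC) := by
  unfold bernoulliMeasure
  infer_instance

/-- Prepending an independent uniform letter preserves the product measure; it suffices to compare
masses of finite boxes. -/
theorem bernoulliMeasure_eq_sum_map_consSeq (hC : C.Nonempty) :
    (C.card : ℝ≥0∞)⁻¹ • ∑ c : C, (bernoulliMeasure C hC).map (consSeq c) =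
      bernoulliMeasure C hC := by
  have : Nonempty C := hC.to_subtype
  refine Measure.eq_infinitePi (μ := fun _ : ℕ => (PMF.uniformOfFintype C).toMeasure)
    fun s t ht => ?_
  classical
  -- Enlarging the index set to an initial segment makes coordinate `0` always present, so it can be
  -- split off.
  obtain ⟨N, hN⟩ : ∃ N, s ⊆ Finset.range (N + 1) :=
    ⟨s.sup id, fun i hi => Finset.mem_range_succ_iff.2 (Finset.le_sup (f := id) hi)⟩
  set t' : ℕ → Set C := fun i => if i ∈ s then t i else Set.univ with ht'
  have hpi : Set.pi (s : Set ℕ) t = Set.pi (Finset.range (N + 1)) t' := by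
    ext ξ
    simp only [Set.mem_pi, ht']
    refine ⟨fun h i _ => ?_, fun h i hi => ?_⟩
    · split_ifs with hi
      · exact h i hi
      · trivial
    · have := h i (hN hi)
      rwa [if_pos (by exact_mod_cast hi)] at this
  have hprod : ∏ i ∈ s, (PMF.uniformOfFintype C).toMeasure (t i) =
      ∏ i ∈ Finset.range (N + 1), (PMF.uniformOfFintype C).toMeasure (t' i) := by
    rw [← Finset.prod_subset hN fun i _ hi => by simp [ht', hi]]
    exact Finset.prod_congr rfl fun i hi => by simp [ht', hi]
  have hmeas : MeasurableSet (Set.pi (Finset.range (N + 1) : Set ℕ) t') :=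
    MeasurableSet.pi (Finset.countable_toSet _) fun i _ => (Set.toFinite _).measurableSet
  have hpre : ∀ c : C, consSeq c ⁻¹' Set.pi (Finset.range (N + 1) : Set ℕ) t' =
      if c ∈ t' 0 then Set.pi (Finset.range N : Set ℕ) fun i => t' (i + 1) else ∅ := by
    intro c
    ext ξ
    have : consSeq c ξ ∈ Set.pi (Finset.range (N + 1) : Set ℕ) t' ↔
        c ∈ t' 0 ∧ ∀ i < N, ξ i ∈ t' (i + 1) := by
      simp only [Set.mem_pi, Finset.coe_range, Set.mem_Iio]
      refine ⟨fun h => ⟨h 0 (by omega), fun i hi => h (i + 1) (by omega)⟩, fun h i hi => ?_⟩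
      cases i with
      | zero => exact h.1
      | succ i => exact h.2 i (by omega)
    rw [Set.mem_preimage, this]
    split_ifs with hc <;> simp [hc, Set.mem_pi]
  rw [hpi, hprod, Finset.prod_range_succ']
  simp only [Measure.smul_apply, Measure.finsetSum_apply, smul_eq_mul]
  simp_rw [Measure.map_apply (measurable_consSeq _) hmeas, hpre]
  have hbox : bernoulliMeasure C hC (Set.pi (Finset.range N : Set ℕ) fun i => t' (i + 1)) =
      ∏ i ∈ Finset.range N, (PMF.uniformOfFintype C).toMeasure (t' (i + 1)) :=
    Measure.infinitePi_pi (μ := fun _ : ℕ => (PMF.uniformOfFintype C).toMeasure)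
      fun i _ => (Set.toFinite _).measurableSet
  rw [PMF.toMeasure_apply_fintype _ (t' 0), mul_comm (∏ i ∈ Finset.range N, _), Finset.sum_mul,
    Finset.mul_sum]
  refine Finset.sum_congr rfl fun c _ => ?_
  by_cases hc : c ∈ t' 0
  · rw [if_pos hc, hbox, Set.indicator_of_mem hc, PMF.uniformOfFintype_apply, Fintype.card_coe]
  · simp [hc]

theorem bernoulliMeasure_apply_eq_sum (hC : C.Nonempty) {S : Set (ℕ → C)} (hS : MeasurableSet S) :
    bernoulliMeasure C hC S =
      (C.card : ℝ≥0∞)⁻¹ * ∑ c : C, bernoulliMeasure C hC (consSeq c ⁻¹' S) := by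
  conv_lhs => rw [← bernoulliMeasure_eq_sum_map_consSeq hC]
  simp only [Measure.smul_apply, Measure.finsetSum_apply, smul_eq_mul,
    Measure.map_apply (measurable_consSeq _) hS]

/-- The sum of all integer translates of the distribution of the random point `expansion B ξ`. -/
noncomputable def latticeSum (B : (Fin n → ℝ) →L[ℝ] (Fin n → ℝ)) (hC : C.Nonempty) :
    Measure (Fin n → ℝ) :=
  Measure.sum fun w : Fin n → ℤ =>
    (bernoulliMeasure C hC).map fun ξ => expansion B ξ - toReal w

theorem measurable_expansion (hB : Summable fun k : ℕ => ‖B ^ k‖) : Measurable (expansion B : (ℕ → C) → Fin n → ℝ) :=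
  (continuous_expansion hB).measurable

theorem latticeSum_apply (hB : Summable fun k : ℕ => ‖B ^ k‖) (hC : C.Nonempty)
    {S : Set (Fin n → ℝ)} (hS : MeasurableSet S) :
    latticeSum B hC S =
      ∑' w : Fin n → ℤ, bernoulliMeasure C hC ((fun ξ => expansion B ξ - toReal w) ⁻¹' S) := by
  rw [latticeSum, Measure.sum_apply _ hS]
  refine tsum_congr fun w => ?_
  rw [Measure.map_apply ((measurable_expansion hB).sub_const _) hS]

theorem latticeSum_add_int (hB : Summable fun k : ℕ => ‖B ^ k‖) (hC : C.Nonempty)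
    {S : Set (Fin n → ℝ)} (hS : MeasurableSet S)
    (z : Fin n → ℤ) :
    latticeSum B hC ((· + toReal z) ⁻¹' S) = latticeSum B hC S := by
  rw [latticeSum_apply hB hC hS, latticeSum_apply hB hC (hS.preimage (measurable_add_const _)),
    ← (Equiv.addRight z).tsum_eq]
  refine tsum_congr fun w => congrArg _ ?_
  ext ξ
  simp only [Equiv.coe_addRight, Set.mem_preimage, toReal_add, sub_add_eq_sub_sub, sub_add_cancel]

end SelfAffine

/-! ### The lattice sum is Lebesgue measure -/

namespace SelfAffine

open Filter Topology
open scoped ENNReal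

variable {n : ℕ} {A : Matrix (Fin n) (Fin n) ℤ} {B : (Fin n → ℝ) →L[ℝ] (Fin n → ℝ)}
  {C : Finset (Fin n → ℤ)}

/-- Every integer vector is uniquely of the form `A w - c` with `c` in a transversal. -/
theorem IsCosetTransversal.bijective_mulVec_sub (hC : IsCosetTransversal A C)
    (hBA : ∀ x, B ((A.map (Int.cast : ℤ → ℝ)).mulVec x) = x) :
    Function.Bijective fun p : (Fin n → ℤ) × C => A.mulVec p.1 - (p.2 : Fin n → ℤ) := by
  constructor
  · rintro ⟨w, c⟩ ⟨w', c'⟩ h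
    simp only at h
    obtain ⟨_, -, huniq⟩ := hC (c : Fin n → ℤ)
    have h1 := huniq c ⟨c.2, 0, by simp⟩
    -- The hypothesis rearranges to `c = c' + A (w - w')`.
    have h2 := huniq c' ⟨c'.2, w - w', by
      rw [Matrix.mulVec_sub, add_sub, eq_sub_iff_add_eq, add_comm _ (A.mulVec w'),
        ← sub_eq_sub_iff_add_eq_add.1 h, add_comm]⟩
    have hcc : c = c' := Subtype.ext (h1.trans h2.symm)
    subst hcc
    have hw : A.mulVec w = A.mulVec w' := sub_left_injective h
    have h3 := congrArg (fun v => B (toReal v)) hw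
    simp only [toReal_mulVec, hBA] at h3
    rw [toReal_injective h3]
  · intro z
    obtain ⟨c, ⟨hc, w, hw⟩, -⟩ := hC (-z)
    refine ⟨(-w, ⟨c, hc⟩), ?_⟩
    simp only [Matrix.mulVec_neg]
    rw [← neg_inj, hw]
    abel

/-- Self-similarity of the lattice sum. -/
theorem latticeSum_eq_preimage (hB : Summable fun k : ℕ => ‖B ^ k‖)
    (hBA : ∀ x, B ((A.map (Int.cast : ℤ → ℝ)).mulVec x) = x) (hC : IsCosetTransversal A C)
    {S : Set (Fin n → ℝ)} (hS : MeasurableSet S) :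
    latticeSum B hC.nonempty S =
      (C.card : ℝ≥0∞)⁻¹ * latticeSum B hC.nonempty (B ⁻¹' S) := by
  -- Splitting off the first letter gives `expansion (cξ) - w = B (expansion ξ - (A w - c))`, and `A
  -- w - c` runs once through `ℤⁿ`.
  rw [latticeSum_apply hB _ hS, latticeSum_apply hB _ (B.continuous.measurable hS), eq_comm,
    ← (Equiv.ofBijective _ (hC.bijective_mulVec_sub hBA)).tsum_eq, ENNReal.tsum_prod',
    ← ENNReal.tsum_mul_left]
  refine tsum_congr fun w => ?_
  rw [bernoulliMeasure_apply_eq_sum _ (((measurable_expansion hB).sub_const (toReal w)) hS),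
    tsum_fintype]
  refine congrArg _ (Finset.sum_congr rfl fun c _ => congrArg _ ?_)
  ext ξ
  have h : expansion B (consSeq c ξ) = B (toReal (c : Fin n → ℤ) + expansion B ξ) :=
    expansion_eq hB _
  simp only [Set.mem_preimage, h, Equiv.ofBijective_apply, toReal_sub, toReal_mulVec, map_sub,
    map_add, hBA]
  rw [← sub_add, add_comm, add_sub]

/-- Pulling back along `B` turns translation by `B ^ (k + 1) z` into translation by `B ^ k z`, so
invariance descends to `ℤⁿ`. -/
theorem latticeSum_add_pow (hB : Summable fun k : ℕ => ‖B ^ k‖)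
    (hBA : ∀ x, B ((A.map (Int.cast : ℤ → ℝ)).mulVec x) = x) (hC : IsCosetTransversal A C)
    (k : ℕ) (z : Fin n → ℤ) {S : Set (Fin n → ℝ)} (hS : MeasurableSet S) :
    latticeSum B hC.nonempty ((· + (B ^ k) (toReal z)) ⁻¹' S) = latticeSum B hC.nonempty S := by
  induction k generalizing S with
  | zero => exact latticeSum_add_int hB _ hS z
  | succ k ih =>
    rw [latticeSum_eq_preimage hB hBA hC (hS.preimage (measurable_add_const _)),
      latticeSum_eq_preimage hB hBA hC hS, ← ih (B.continuous.measurable hS), pow_succ' B k]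
    congr 2
    ext x
    simp

/-- Expansions are uniformly bounded, so only finitely many translates meet a given compact set. -/
theorem isFiniteMeasureOnCompacts_latticeSum (hB : Summable fun k : ℕ => ‖B ^ k‖)
    (hC : C.Nonempty) : IsFiniteMeasureOnCompacts (latticeSum B hC) := by
  obtain ⟨R, hR⟩ := exists_norm_expansion_le hB C
  refine ⟨fun S hS => ?_⟩
  obtain ⟨R', hR'⟩ := hS.isBounded.exists_norm_le
  rw [latticeSum_apply hB _ hS.measurableSet,
    tsum_eq_sum (s := (finite_setOf_norm_toReal_le n (R + R')).toFinset)]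
  · exact ENNReal.sum_lt_top.2 fun _ _ => measure_lt_top _ _
  · intro w hw
    convert measure_empty (μ := bernoulliMeasure C hC)
    rw [Set.eq_empty_iff_forall_notMem]
    intro ξ hξ
    refine hw ?_
    simp only [Set.Finite.mem_toFinset, Set.mem_ofPred_eq]
    have h := hR' _ hξ
    calc ‖toReal w‖ = ‖expansion B ξ - (expansion B ξ - toReal w)‖ := by rw [sub_sub_cancel]
      _ ≤ R + R' := (norm_sub_le _ _).trans (add_le_add (hR ξ) h)

/-- Write `x = B ^ k y` and round `y` down: the error is `B ^ k` of a vector in the unit cube, which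
tends to `0`. -/
theorem dense_range_pow_toReal (hB : Summable fun k : ℕ => ‖B ^ k‖)
    (hBA : ∀ x, B ((A.map (Int.cast : ℤ → ℝ)).mulVec x) = x) :
    Dense (Set.range fun p : ℕ × (Fin n → ℤ) => (B ^ p.1) (toReal p.2)) := by
  intro x
  have hinv : ∀ k : ℕ, ∃ y, (B ^ k) y = x := by
    intro k
    induction k with
    | zero => exact ⟨x, rfl⟩
    | succ k ih =>
      obtain ⟨y, hy⟩ := ih
      refine ⟨(A.map (Int.cast : ℤ → ℝ)).mulVec y, ?_⟩
      rw [pow_succ, mul_apply_eq_comp, hBA, hy]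
  choose y hy using hinv
  have h0 := tendsto_pow_apply_of_bounded hB (x := fun k => y k - toReal fun i => ⌊y k i⌋) (M := 1)
    fun k => (pi_norm_le_iff_of_nonneg zero_le_one).2 fun i => by
      simp only [Pi.sub_apply, toReal, Int.self_sub_floor, Real.norm_eq_abs, Int.abs_fract]
      exact (Int.fract_lt_one _).le
  simp only [map_sub, hy] at h0
  have h1 : Tendsto (fun k => (B ^ k) (toReal fun i => ⌊y k i⌋)) atTop (𝓝 x) := by
    simpa using (tendsto_const_nhds (x := x)).sub h0
  exact mem_closure_of_tendsto h1 (Eventually.of_forall fun k => ⟨(k, _), rfl⟩)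

/-- The half-open unit cube has mass one for the lattice sum. -/
theorem latticeSum_unitCube (hB : Summable fun k : ℕ => ‖B ^ k‖) (hC : C.Nonempty) :
    latticeSum B hC (Set.univ.pi fun _ => Set.Ico 0 1) = 1 := by
  have hQ : MeasurableSet (Set.univ.pi fun _ : Fin n => Set.Ico (0 : ℝ) 1) :=
    MeasurableSet.univ_pi fun _ => measurableSet_Ico
  have hmem : ∀ (x : Fin n → ℝ) (w : Fin n → ℤ),
      x - toReal w ∈ (Set.univ.pi fun _ : Fin n => Set.Ico (0 : ℝ) 1) ↔ w = fun i => ⌊x i⌋ := by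
    intro x w
    simp only [Set.mem_pi, Set.mem_univ, true_imp_iff, Set.mem_Ico, funext_iff]
    refine forall_congr' fun i => ?_
    rw [eq_comm, Int.floor_eq_iff]
    simp only [Pi.sub_apply, toReal]
    constructor <;> rintro ⟨h1, h2⟩ <;> constructor <;> linarith
  -- Each `ξ` is counted for exactly one `w`, the integer part of its expansion, so the events
  -- partition the probability space.
  rw [latticeSum_apply hB _ hQ, ← measure_iUnion]
  · convert measure_univ (μ := bernoulliMeasure C hC)
    refine Set.eq_univ_of_forall fun ξ => Set.mem_iUnion.2 ⟨_, (hmem _ _).2 rfl⟩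
  · intro w w' hne
    refine Set.disjoint_left.2 fun ξ h h' => hne ?_
    rw [(hmem _ _).1 h, (hmem _ _).1 h']
  · exact fun w => ((measurable_expansion hB).sub_const _) hQ

/-- For a complete digit set, the integer translates of the distribution of the random expansion
add up to the Lebesgue measure. -/
theorem latticeSum_eq_volume (hB : Summable fun k : ℕ => ‖B ^ k‖)
    (hBA : ∀ x, B ((A.map (Int.cast : ℤ → ℝ)).mulVec x) = x)
    (hC : IsCosetTransversal A C) :
    latticeSum B hC.nonempty = volume := by
  have := isFiniteMeasureOnCompacts_latticeSum hB hC.nonempty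
  have : (latticeSum B hC.nonempty).IsAddLeftInvariant := by
    refine isAddLeftInvariant_of_dense (dense_range_pow_toReal hB hBA) ?_
    rintro _ ⟨⟨k, z⟩, rfl⟩
    ext S hS
    rw [Measure.map_apply (measurable_const_add _) hS, ← latticeSum_add_pow hB hBA hC k z hS]
    simp only [add_comm]
  have h := Measure.isAddLeftInvariant_eq_smul (latticeSum B hC.nonempty) volume
  have hQ := congrArg (fun m => m (Set.univ.pi fun _ : Fin n => Set.Ico (0 : ℝ) 1)) h
  simp only [latticeSum_unitCube hB, Measure.smul_apply, volume_pi_pi, Real.volume_Ico, sub_zero,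
    ENNReal.ofReal_one, Finset.prod_const_one] at hQ
  have hc : Measure.addHaarScalarFactor (latticeSum B hC.nonempty) volume = 1 := by
    simpa [ENNReal.smul_def] using hQ.symm
  rw [h, hc, one_smul]

end SelfAffine

/-! ### Measure of the intersection -/

theorem mainTheorem3 (n : ℕ) (A : Matrix (Fin n) (Fin n) ℤ) (hA : SelfAffine.IsExpanding A)
    (D K C : Finset (Fin n → ℤ)) (hDK : D ⊆ K) (hCK : C ⊆ K)
    (hC : SelfAffine.IsCosetTransversal A C)
    (T : Set (Fin n → ℝ)) (hT : SelfAffine.IsSelfAffineSet A D T) (u : Fin n → ℤ) :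
    (SelfAffine.digitGraph A K C D).verts.Finite ∧
    (∀ v, IsClosed ((SelfAffine.digitGraph A K C D).pathSet v)) ∧
    volume (T ∩ SelfAffine.translateBy T u) =
      ∑' p : {p : (Fin n → ℤ) × (Fin n → ℤ) //
          p.1 ∈ (SelfAffine.digitGraph A K C D).verts ∧
          p.2 ∈ (SelfAffine.digitGraph A K C D).verts ∧ u = p.2 - p.1},
        SelfAffine.bernoulliMeasure C hC.nonempty
          ((SelfAffine.digitGraph A K C D).pathSet p.1.1 ∩
            (SelfAffine.digitGraph A K C D).pathSet p.1.2) ∧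
    ∀ v₁ ∈ (SelfAffine.digitGraph A K C D).verts, ∀ v₂ ∈ (SelfAffine.digitGraph A K C D).verts,
      ((SelfAffine.digitGraph A K C D).labeledProd (SelfAffine.digitGraph A K C D)).pathSet
          (v₁, v₂) =
        (SelfAffine.digitGraph A K C D).pathSet v₁ ∩
          (SelfAffine.digitGraph A K C D).pathSet v₂ := by
  obtain ⟨B, hBA, hAB, hB⟩ := hA.exists_inverse
  have hmem := SelfAffine.mem_pathSet_digitGraph_iff (C := C) hT hDK hCK hB hBA hAB
  refine ⟨SelfAffine.finite_digitGraph_verts hA K C D, fun v => ?_, ?_,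
    fun v₁ _ v₂ _ => LabeledGraph.pathSet_labeledProd _ _ v₁ v₂⟩
  · have h : (SelfAffine.digitGraph A K C D).pathSet v =
        (fun ξ => SelfAffine.expansion B ξ - SelfAffine.toReal v) ⁻¹' T := Set.ext (hmem v)
    rw [h]
    exact hT.isCompact.isClosed.preimage
      ((SelfAffine.continuous_expansion hB).sub continuous_const)
  · have hTm := hT.isCompact.measurableSet
    have hTu : MeasurableSet (SelfAffine.translateBy T u) :=
      (hT.isCompact.image (continuous_id.add continuous_const)).measurableSet
    have hverts : ∀ {v ξ}, ξ ∈ (SelfAffine.digitGraph A K C D).pathSet v →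
        v ∈ (SelfAffine.digitGraph A K C D).verts := by
      rintro v ξ ⟨p, rfl, hp⟩
      exact (SelfAffine.digitGraph A K C D).target_mem (hp 0)
    rw [← SelfAffine.latticeSum_eq_volume hB hBA hC,
      SelfAffine.latticeSum_apply hB _ (hTm.inter hTu)]
    have hset : ∀ w, (fun ξ : ℕ → C => SelfAffine.expansion B ξ - SelfAffine.toReal w) ⁻¹'
        (T ∩ SelfAffine.translateBy T u) = (SelfAffine.digitGraph A K C D).pathSet w ∩
          (SelfAffine.digitGraph A K C D).pathSet (w + u) := by
      intro w
      ext ξ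
      rw [Set.mem_preimage, Set.mem_inter_iff, Set.mem_inter_iff, hmem, hmem,
        SelfAffine.mem_translateBy, SelfAffine.toReal_add, sub_sub]
    simp only [hset]
    have hinj : Function.Injective fun p : {p : (Fin n → ℤ) × (Fin n → ℤ) //
        p.1 ∈ (SelfAffine.digitGraph A K C D).verts ∧
        p.2 ∈ (SelfAffine.digitGraph A K C D).verts ∧ u = p.2 - p.1} => p.1.1 := by
      rintro ⟨⟨v₁, v₂⟩, -, -, h⟩ ⟨⟨w₁, w₂⟩, -, -, h'⟩ (rfl : v₁ = w₁)
      simp only [Subtype.mk.injEq, Prod.mk.injEq, true_and]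
      exact sub_left_injective (h.symm.trans h')
    -- A pair is determined by its first vertex. Any other `w` contributes zero, since a nonempty
    -- path set forces its end vertex into the graph.
    rw [← hinj.tsum_eq]
    · refine tsum_congr fun p => ?_
      have hp : p.1.1 + u = p.1.2 := add_eq_of_eq_sub' p.2.2.2
      rw [hp]
    · intro w hw
      obtain ⟨ξ, h1, h2⟩ := nonempty_of_measure_ne_zero hw
      exact ⟨⟨(w, w + u), hverts h1, hverts h2, by simp⟩, rfl⟩
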